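/- All graphs are finite and simple. For a graph $G$, let $F_2(G)$ (the double vertex graph) be the graph whose vertices are the $2$-element subsets of $V(G)$, and let $M_2(G)$ (the complete double vertex graph) be the graph whose vertices are the multisets of size $2$ with elements in $V(G)$; in both graphs two vertices $A,B$ are adjacent exactly when their symmetric difference (for $M_2(G)$: the multiset symmetric difference $(A-B)+(B-A)$) is a pair $\{a,b\}$ with $ab\in E(G)$. The join $G_1+G_2$ of two disjoint graphs has vertex set $V(G_1)\cup V(G_2)$ and edge set $E(G_1)\cup E(G_2)\cup\{uv : u\in V(G_1),\ v\in V(G_2)\}$. A graph is Hamiltonian if it contains a Hamiltonian cycle, that is, a cycle containing every vertex exactly once; a Hamiltonian path is a path containing every vertex exactly once. Let $G_1$ and $G_2$ be two disjoint graphs of order $m\ge 1$ and $n\ge 2$, respectively, such that $G_2$ has a Hamiltonian path, and let $G=G_1+G_2$. If $m\le 2n$, then $F_2(G)$ is Hamiltonian, and if $m\le 2(n-1)$, then $M_2(G)$ is Hamiltonian. -/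

import Mathlib

namespace SimpleGraph

/-- The join `G₁ + G₂` of two graphs on the disjoint union of their vertex sets: the edges of `G₁`,
the edges of `G₂`, and all edges between a vertex of `G₁` and a vertex of `G₂`. -/
def joinGraph {V W : Type*} (G₁ : SimpleGraph V) (G₂ : SimpleGraph W) : SimpleGraph (V ⊕ W) :=
  (G₁ ⊕g G₂) ⊔ completeBipartiteGraph V W

/-- The `k`-token graph `F_k(G)`: the vertices are the `k`-subsets of the vertex set of `G`, and two
of them are adjacent if their symmetric difference is a pair of adjacent vertices of `G`. -/
def tokenGraph {V : Type*} [DecidableEq V] (G : SimpleGraph V) (k : ℕ) :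
    SimpleGraph {s : Finset V // s.card = k} where
  Adj A B := ∃ a b : V, G.Adj a b ∧ symmDiff A.1 B.1 = {a, b}
  symm := ⟨by
    rintro A B ⟨a, b, hab, h⟩
    exact ⟨a, b, hab, by rw [symmDiff_comm, h]⟩⟩
  loopless := ⟨by
    rintro A ⟨a, b, _, h⟩
    rw [symmDiff_self] at h
    exact (Finset.insert_ne_empty a {b}) h.symm⟩

/-- The `k`-multiset graph `M_k(G)`: the vertices are the multisets of `k` vertices of `G`, and two
of them are adjacent if their symmetric difference as multisets, `(A - B) + (B - A)`, is a pair of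
adjacent vertices of `G`. -/
def multisetGraph {V : Type*} [DecidableEq V] (G : SimpleGraph V) (k : ℕ) :
    SimpleGraph (Sym V k) where
  Adj A B := ∃ a b : V, G.Adj a b ∧
    ((A : Multiset V) - (B : Multiset V)) + ((B : Multiset V) - (A : Multiset V)) = {a, b}
  symm := ⟨by
    rintro A B ⟨a, b, hab, h⟩
    exact ⟨a, b, hab, by rw [add_comm, h]⟩⟩
  loopless := ⟨by
    rintro A ⟨a, b, _, h⟩
    have h' := congrArg Multiset.card h
    simp at h'⟩

/-- The double vertex graph `F₂(G)`. -/
abbrev doubleVertexGraph {V : Type*} [DecidableEq V] (G : SimpleGraph V) :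
    SimpleGraph {s : Finset V // s.card = 2} :=
  G.tokenGraph 2

/-- The complete double vertex graph `M₂(G)`. -/
abbrev completeDoubleVertexGraph {V : Type*} [DecidableEq V] (G : SimpleGraph V) :
    SimpleGraph (Sym V 2) :=
  G.multisetGraph 2

/-- `G` has a Hamiltonian path. -/
def HasHamiltonianPath {V : Type*} [DecidableEq V] (G : SimpleGraph V) : Prop :=
  ∃ (u v : V) (p : G.Walk u v), p.IsHamiltonian

end SimpleGraph

/-! Only the join edges and the Hamiltonian path `0, 1, …, n - 1` of the second graph are used.
Write `wv i k` for a mixed pair. For fixed `i` these form a row, which is a path. Every `ww` pair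
containing `i` is adjacent to the whole row, so it can be inserted between two consecutive entries.
At the end of a row `ww i (i + 1)` leads to the next one, and the `vv` pairs go into the last row
and close the cycle. It remains to place the other `ww` pairs. Let `N` be `n`, or `n - 1` when equal
pairs count and each takes a gap of its row. The first `m - 1` rows have `N - 1` free gaps each, and
`(m - 1) * (m - 2) / 2` pairs `ww i j` with `j ≥ i + 2` need one, so there is room when `m ≤ 2 * N`.
A rotational tournament gives an explicit assignment. `mem_block` verifies it through the position
function `pos`, and `isChain_cycle` verifies adjacency. -/

namespace List

/-! ### Chains and duplicate-freeness of concatenated lists. -/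

variable {α : Type*}

/-- Each piece is tested together with the head of the next one, so the seams are covered. -/
theorem isChain_flatMap_range_append {R : α → α → Prop} (f : ℕ → List α) (h : ℕ → α) (T : ℕ)
    (hhead : ∀ t < T, ∃ l, f t = h t :: l)
    (hchain : ∀ t < T, (f t ++ [h (t + 1)]).IsChain R) :
    ((range T).flatMap f ++ [h T]).IsChain R := by
  induction T with
  | zero => simp
  | succ T ih =>
    have ih' := ih (fun t ht => hhead t (by omega)) (fun t ht => hchain t (by omega))
    obtain ⟨l, hl⟩ := hhead T (by omega)
    have hT := hchain T (by omega)
    rw [hl] at hT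
    simp only [range_succ, flatMap_append, flatMap_cons, flatMap_nil, append_nil, hl]
    rw [append_assoc, cons_append]
    exact isChain_split.2 ⟨ih', by simpa using hT⟩

theorem nodup_flatMap_range (f : ℕ → List α) (idx : α → ℕ) (T : ℕ)
    (hnodup : ∀ t < T, (f t).Nodup) (hidx : ∀ t < T, ∀ a ∈ f t, idx a = t) :
    ((range T).flatMap f).Nodup := by
  induction T with
  | zero => simp
  | succ T ih =>
    simp only [range_succ, flatMap_append, flatMap_cons, flatMap_nil, append_nil]
    refine nodup_append'.2 ⟨ih (fun t ht => hnodup t (by omega)) (fun t ht => hidx t (by omega)),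
      hnodup T (by omega), ?_⟩
    intro a ha ha'
    obtain ⟨t, ht, hat⟩ := mem_flatMap.1 ha
    have h1 := hidx t (by have := mem_range.1 ht; omega) a hat
    have h2 := hidx T (by omega) a ha'
    have := mem_range.1 ht
    omega

/-- The list `[f (a + l - 1), …, f (a + 1), f a]`. -/
def descend (f : ℕ → α) (a : ℕ) : ℕ → List α
  | 0 => []
  | l + 1 => f (a + l) :: descend f a l

theorem mem_descend {f : ℕ → α} {a l : ℕ} {x : α} :
    x ∈ descend f a l ↔ ∃ j, a ≤ j ∧ j < a + l ∧ x = f j := by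
  induction l with
  | zero => simp [descend]; intros; omega
  | succ l ih =>
    simp only [descend, mem_cons, ih]
    constructor
    · rintro (rfl | ⟨j, h1, h2, rfl⟩)
      · exact ⟨a + l, by omega, by omega, rfl⟩
      · exact ⟨j, h1, by omega, rfl⟩
    · rintro ⟨j, h1, h2, rfl⟩
      by_cases h : j = a + l
      · exact Or.inl (by rw [h])
      · exact Or.inr ⟨j, h1, by omega, rfl⟩

theorem nodup_descend {f : ℕ → α} (hf : Function.Injective f) (a l : ℕ) :
    (descend f a l).Nodup := by
  induction l with
  | zero => simp [descend]
  | succ l ih =>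
    refine nodup_cons.2 ⟨fun h => ?_, ih⟩
    obtain ⟨j, -, h2, h3⟩ := mem_descend.1 h
    have := hf h3
    omega

theorem isChain_cons_descend_append {R : α → α → Prop} {f : ℕ → α} (a l : ℕ) {x : α}
    {rest : List α} (hl : 0 < l) (hx : R x (f (a + l - 1))) (hf : ∀ j, R (f (j + 1)) (f j))
    (hrest : (f a :: rest).IsChain R) : (x :: (descend f a l ++ rest)).IsChain R := by
  induction l generalizing x with
  | zero => omega
  | succ l ih =>
    simp only [descend, cons_append, isChain_cons_cons]
    refine ⟨by simpa using hx, ?_⟩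
    rcases Nat.eq_zero_or_pos l with rfl | hl'
    · simpa [descend] using hrest
    · refine ih hl' ?_
      obtain ⟨k, rfl⟩ : ∃ k, l = k + 1 := ⟨l - 1, by omega⟩
      exact hf (a + k)

end List

/-! ### From a closed chain to a Hamiltonian cycle. -/

namespace SimpleGraph

theorem isHamiltonian_of_isChain {α : Type*} [Fintype α] [DecidableEq α] {G : SimpleGraph α}
    (a : α) (l : List α) (hchain : (a :: l ++ [a]).IsChain G.Adj) (hnodup : (a :: l).Nodup)
    (hmem : ∀ x, x ∈ a :: l) (hlen : 2 ≤ l.length) : G.IsHamiltonian := by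
  intro _
  let q := Walk.ofSupport (a :: l ++ [a]) (by simp) hchain
  have hq : q.support = a :: l ++ [a] := Walk.support_ofSupport _ _
  obtain ⟨p, hp⟩ : ∃ p : G.Walk a a, p.support = a :: l ++ [a] :=
    ⟨q.copy (by simp) (by simp), (Walk.support_copy ..).trans hq⟩
  have hnil : ¬ p.Nil := by
    intro h
    rw [Walk.nil_iff_support_eq.1 h] at hp
    simp at hp
  have htail : p.tail.support = l ++ [a] := by
    rw [Walk.support_tail_of_not_nil _ hnil, hp]; simp
  have hlength : p.length = l.length + 1 := by
    have := congrArg List.length hp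
    simpa using this
  have hpath : p.tail.IsPath := by
    refine Walk.IsPath.mk' ?_
    rw [htail]
    exact (List.perm_append_singleton a l).nodup_iff.2 hnodup
  refine ⟨a, p, ⟨Walk.isCycle_iff_isPath_tail_and_le_length.2 ⟨hpath, by omega⟩, ?_⟩⟩
  refine hpath.isHamiltonian_of_mem fun x => ?_
  rw [htail]
  exact (List.perm_append_singleton a l).mem_iff.2 (hmem x)

end SimpleGraph

/-! ### The combinatorial cycle on codes. -/

/-- Names for the pairs of vertices of a join: `ww i j` is a pair inside the first graph, `vv k l` a
pair inside the second one, and `wv i k` consists of one vertex of each graph. -/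
inductive PairCode : Type
  | ww (i j : ℕ)
  | wv (i k : ℕ)
  | vv (k l : ℕ)

namespace PairCode

open List

/-- The codes of the pairs when the two graphs have orders `m` and `n`; the pairs of equal elements
are included if `d` is true. -/
def Valid (m n : ℕ) (d : Bool) : PairCode → Prop
  | ww i j => (i < j ∨ d ∧ i = j) ∧ j < m
  | wv i k => i < m ∧ k < n
  | vv k l => (k < l ∨ d ∧ k = l) ∧ l < n

/-- Adjacency of pairs when the first graph is empty and the second one is the path
`0, 1, 2, …`. -/
def Adj : PairCode → PairCode → Prop
  | wv i _, ww a b => i = a ∨ i = b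
  | ww a b, wv i _ => i = a ∨ i = b
  | wv _ k, vv a b => k = a ∨ k = b
  | vv a b, wv _ k => k = a ∨ k = b
  | wv i k, wv i' k' => i = i' ∧ k' = k + 1
  | vv a b, vv a' b' => a = a' ∧ (b = b' + 1 ∨ b' = b + 1) ∨ b = b' ∧ (a = a' + 1 ∨ a' = a + 1)
  | ww _ _, _ => False
  | vv _ _, ww _ _ => False

/-- The pairs inserted into row `i < m - 1` after `wv i k`. The pairs inside the first graph are
distributed over the rows by a rotational tournament on `2 * N - 1` vertices, where `N` is `n - 1`
or `n` according to `d`. -/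
def rowFill (m n : ℕ) (d : Bool) (i k : ℕ) : List PairCode :=
  if k + 1 = n then [ww i (i + 1)]
  else if k + 2 = n ∧ d then [ww i i]
  else
    let M := 2 * (if d then n - 1 else n) - 1
    if k = 0 then
      if i + 2 < m then [ww i (m - 1)] else if i + 1 = M then [ww 0 i] else []
    else if i + k + 2 < m then [ww i (i + k + 1)]
    else if M ≤ i + k + 1 then [ww (i + k + 1 - M) i] else []

/-- The pairs that close the cycle after `wv (m - 1) (n - 1)`. -/
def closing (n : ℕ) (d : Bool) : List PairCode :=
  if n = 2 then (if d then [vv 1 1, vv 0 1, vv 0 0] else [vv 0 1])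
  else (if d then [vv (n - 1) (n - 1)] else []) ++
    (descend (fun j => vv j (n - 1)) 1 (n - 2) ++ descend (fun j => vv 0 j) 2 (n - 2))

/-- The pairs inserted into the last row after `wv (m - 1) k`. -/
def lastFill (m n : ℕ) (d : Bool) (k : ℕ) : List PairCode :=
  if k + 1 = n then closing n d
  else if k + 2 = n then (if d then [ww (m - 1) (m - 1)] else [])
  else if k = 0 then (if d then [vv 0 0, vv 0 1, vv 1 1] else [vv 0 1])
  else descend (fun j => vv k j) (k + 1) (n - 2 - k) ++
    (if d then [vv (k + 1) (k + 1)] else [])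

/-- The part of the cycle from `wv i k` up to the next code of this form. -/
def block (m n : ℕ) (d : Bool) (i k : ℕ) : List PairCode :=
  wv i k :: if i + 1 = m then lastFill m n d k else rowFill m n d i k

/-- The position of a code in the cycle: the indices of the block that contains it. -/
def pos (m n : ℕ) (d : Bool) : PairCode → ℕ × ℕ
  | wv i k => (i, k)
  | ww a b =>
    let N := if d then n - 1 else n
    if a = b then (a, n - 2)
    else if b = a + 1 then (a, n - 1)
    else if b + 1 = m then (a, 0)
    else if b - a < N then (a, b - a - 1)
    else (b, 2 * N - 2 - (b - a))
  | vv a b =>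
    if n = 2 then (m - 1, 1)
    else if b + 1 = n then (m - 1, n - 1)
    else if a = 0 then (if b ≤ 1 then (m - 1, 0) else (m - 1, n - 1))
    else if a < b then (m - 1, a) else (m - 1, a - 1)

variable {m n : ℕ} {d : Bool}

theorem mem_closing (hn : 2 ≤ n) {c : PairCode} :
    c ∈ closing n d ↔ ∃ a b, c = vv a b ∧ (a < b ∨ d ∧ a = b) ∧ b < n ∧
      (n = 2 ∨ b + 1 = n ∨ a = 0 ∧ 2 ≤ b) := by
  by_cases h : n = 2
  · subst h
    cases d <;> simp [closing] <;> grind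
  · cases c with
    | vv a b =>
      have h1 : (∃ j, 1 ≤ j ∧ j < 1 + (n - 2) ∧ vv a b = vv j (n - 1)) ↔
          b = n - 1 ∧ 1 ≤ a ∧ a < n - 1 := by grind
      have h2 : (∃ j, 2 ≤ j ∧ j < 2 + (n - 2) ∧ vv a b = vv 0 j) ↔
          a = 0 ∧ 2 ≤ b ∧ b < n := by grind
      cases d <;> simp only [closing, if_neg h, mem_append, mem_descend, h1, h2] <;>
        clear h1 h2 <;> grind
    | _ => cases d <;> simp [closing, mem_append, mem_descend, h]

/-- For `n > 2`, `closing` takes the column `vv _ (n - 1)` and the row `vv 0 _` from `2` on. The gap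
after `k ≥ 1` takes the rest of row `k`, descending to `vv k (k + 1)`, which is adjacent to the next
entry. An equal pair `vv (k + 1) (k + 1)` fits just behind it. -/
theorem mem_lastFill (hm : 1 ≤ m) (hn : 2 ≤ n) {k : ℕ} (hk : k < n) {c : PairCode} :
    c ∈ lastFill m n d k ↔ c ≠ wv (m - 1) k ∧ c.Valid m n d ∧ c.pos m n d = (m - 1, k) := by
  unfold lastFill
  split_ifs with h1 h2 hd h3 hd hd
  · rw [mem_closing hn]
    cases c <;> simp only [Valid, pos] <;> grind (splits := 25)
  · cases c <;> simp only [Valid, pos] <;> grind (splits := 25)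
  · cases c <;> simp only [Valid, pos] <;> grind (splits := 25)
  · cases c <;> simp only [Valid, pos] <;> grind (splits := 25)
  · cases c <;> simp only [Valid, pos] <;> grind (splits := 25)
  · rw [mem_append, mem_descend]
    cases c <;> simp only [Valid, pos] <;> grind (splits := 25)
  · rw [mem_append, mem_descend]
    cases c <;> simp only [Valid, pos] <;> grind (splits := 25)

/-- On the residues modulo `M = 2 * N - 1`, let `i` beat `i + 1, …, i + N - 1`; each pair is then
owned by exactly one row. The pair with `i + k + 1` sits in gap `k ≥ 1`, and `ww i (i + 1)` ends the
row. The vertex `m - 1` stays outside the tournament, its pairs using gap `0`. Row `m - 2` has that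
gap free, and it receives the wrap-around pair `ww 0 (M - 1)` when `m = 2 * N`. The bound on `m`
says that `0, …, m - 2` fit among the residues. -/
theorem mem_rowFill (hn : 2 ≤ n) (hmn : m ≤ 2 * (if d then n - 1 else n)) {i k : ℕ}
    (hi : i + 1 < m) (hk : k < n) {c : PairCode} :
    c ∈ rowFill m n d i k ↔ c ≠ wv i k ∧ c.Valid m n d ∧ c.pos m n d = (i, k) := by
  cases d <;> cases c <;> simp only [rowFill, Valid, pos] <;> grind (splits := 25)

/-- Blocks are the fibres of `pos` on valid codes, which yields both disjointness and coverage. -/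
theorem mem_block (hn : 2 ≤ n) (hmn : m ≤ 2 * (if d then n - 1 else n)) {i k : ℕ}
    (hi : i < m) (hk : k < n) {c : PairCode} :
    c ∈ block m n d i k ↔ c.Valid m n d ∧ c.pos m n d = (i, k) := by
  have h : c ∈ block m n d i k ↔ c = wv i k ∨ c ≠ wv i k ∧ c.Valid m n d ∧ c.pos m n d = (i, k) := by
    unfold block
    split_ifs with h
    · obtain rfl : i = m - 1 := by omega
      rw [mem_cons, mem_lastFill (by omega) hn hk]
    · rw [mem_cons, mem_rowFill hn hmn (by omega) hk]
  have h' : c = wv i k → c.Valid m n d ∧ c.pos m n d = (i, k) := by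
    rintro rfl
    exact ⟨⟨hi, hk⟩, rfl⟩
  tauto

theorem nodup_block (hn : 2 ≤ n) (i k : ℕ) : (block m n d i k).Nodup := by
  have hcol : Function.Injective fun j => vv j (n - 1) := fun _ _ h => by simpa using h
  have hrow : ∀ k, Function.Injective fun j => vv k j := fun _ _ _ h => by simpa using h
  unfold block
  refine nodup_cons.2 ⟨fun h => ?_, ?_⟩
  · split_ifs at h
    · unfold lastFill closing at h
      split_ifs at h <;> simp [mem_descend] at h
    · unfold rowFill at h
      simp only at h
      split_ifs at h <;> simp at h
  · split_ifs
    · unfold lastFill closing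
      split_ifs <;>
        simp [nodup_append', nodup_descend, hcol, hrow, mem_descend, List.Disjoint] <;> grind
    · unfold rowFill
      simp only
      split_ifs <;> simp

theorem isChain_block (hm : 1 ≤ m) {i k : ℕ} (hk : k + 1 < n) :
    (block m n d i k ++ [wv i (k + 1)]).IsChain Adj := by
  unfold block
  split_ifs with hi
  · unfold lastFill
    split_ifs with h1 h2 hd h3 hd hd
    · omega
    · simp [Adj]; omega
    · simp [Adj]
    · subst h3; simp [Adj]
    · subst h3; simp [Adj]
    · rw [cons_append, append_assoc]
      refine isChain_cons_descend_append _ _ (by omega) ?_ (fun j => ?_) ?_ <;> simp [Adj]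
    · rw [cons_append, append_assoc]
      refine isChain_cons_descend_append _ _ (by omega) ?_ (fun j => ?_) ?_ <;> simp [Adj]
  · unfold rowFill
    simp only
    split_ifs <;> simp [Adj]

theorem isChain_block_last (hn : 2 ≤ n) {i : ℕ} :
    (block m n d i (n - 1) ++ [if i + 1 = m then wv 0 0 else wv (i + 1) 0]).IsChain Adj := by
  have hn1 : n - 1 + 1 = n := by omega
  unfold block
  split_ifs with hi
  · rw [lastFill, if_pos hn1, closing]
    split_ifs with h2 hd hd
    · subst h2; simp [Adj]
    · subst h2; simp [Adj]
    · simp only [cons_append, nil_append, append_assoc, isChain_cons_cons]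
      refine ⟨by simp [Adj], ?_⟩
      refine isChain_cons_descend_append _ _ (by omega) ?_ (fun j => ?_)
        (isChain_cons_descend_append _ _ (by omega) ?_ (fun j => ?_) ?_) <;> simp [Adj] <;> omega
    · simp only [cons_append, nil_append, append_assoc]
      refine isChain_cons_descend_append _ _ (by omega) ?_ (fun j => ?_)
        (isChain_cons_descend_append _ _ (by omega) ?_ (fun j => ?_) ?_) <;> simp [Adj] <;> omega
  · simp [rowFill, hn1, Adj]

/-! ### Assembling the blocks. -/

/-- The whole cycle. -/
def cycle (m n : ℕ) (d : Bool) : List PairCode :=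
  (range m).flatMap fun i => (range n).flatMap (block m n d i)

theorem mem_cycle (hm : 1 ≤ m) (hn : 2 ≤ n) (hmn : m ≤ 2 * (if d then n - 1 else n)) {c : PairCode} :
    c ∈ cycle m n d ↔ c.Valid m n d := by
  constructor
  · intro h
    obtain ⟨i, hi, h⟩ := mem_flatMap.1 h
    obtain ⟨k, hk, h⟩ := mem_flatMap.1 h
    exact ((mem_block hn hmn (mem_range.1 hi) (mem_range.1 hk)).1 h).1
  · intro h
    have hpos : (c.pos m n d).1 < m ∧ (c.pos m n d).2 < n := by
      cases d <;> cases c <;> simp only [Valid, pos] at h ⊢ <;> grind (splits := 25)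
    refine mem_flatMap.2 ⟨_, mem_range.2 hpos.1, mem_flatMap.2 ⟨_, mem_range.2 hpos.2, ?_⟩⟩
    exact (mem_block hn hmn hpos.1 hpos.2).2 ⟨h, rfl⟩

theorem nodup_cycle (hn : 2 ≤ n) (hmn : m ≤ 2 * (if d then n - 1 else n)) :
    (cycle m n d).Nodup := by
  refine nodup_flatMap_range _ (fun c => (c.pos m n d).1) m (fun i hi => ?_) (fun i hi c hc => ?_)
  · refine nodup_flatMap_range _ (fun c => (c.pos m n d).2) n (fun k _ => nodup_block hn i k)
      (fun k hk c hc => ?_)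
    rw [((mem_block hn hmn hi hk).1 hc).2]
  · obtain ⟨k, hk, hc⟩ := mem_flatMap.1 hc
    rw [((mem_block hn hmn hi (mem_range.1 hk)).1 hc).2]

theorem cycle_eq_cons (hm : 1 ≤ m) (hn : 2 ≤ n) : ∃ l, cycle m n d = wv 0 0 :: l := by
  obtain ⟨m, rfl⟩ : ∃ m', m = m' + 1 := ⟨m - 1, by omega⟩
  obtain ⟨n, rfl⟩ : ∃ n', n = n' + 1 := ⟨n - 1, by omega⟩
  exact ⟨_, by simp only [cycle, range_succ_eq_map, flatMap_cons, block, cons_append]; rfl⟩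

theorem isChain_cycle (hm : 1 ≤ m) (hn : 2 ≤ n) :
    (cycle m n d ++ [wv 0 0]).IsChain Adj := by
  -- The head with index `m` is the starting code, so the last seam closes the cycle.
  have key := isChain_flatMap_range_append (R := Adj)
    (fun i => (range n).flatMap (block m n d i)) (fun i => if i = m then wv 0 0 else wv i 0) m
    (fun i hi => ?_) (fun i hi => ?_)
  · simpa [cycle] using key
  · obtain ⟨n, rfl⟩ : ∃ n', n = n' + 1 := ⟨n - 1, by omega⟩
    rw [if_neg (by omega)]
    exact ⟨_, by simp only [range_succ_eq_map, flatMap_cons, block, cons_append]; rfl⟩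
  · have row := isChain_flatMap_range_append (R := Adj) (block m n d i)
      (fun k => if k = n then (if i + 1 = m then wv 0 0 else wv (i + 1) 0) else wv i k) n
      (fun k hk => ?_) (fun k hk => ?_)
    · simpa using row
    · rw [if_neg (by omega)]
      exact ⟨_, rfl⟩
    · by_cases h : k + 1 = n
      · obtain rfl : k = n - 1 := by omega
        rw [if_pos h]
        exact isChain_block_last hn
      · rw [if_neg h]
        exact isChain_block hm (by omega)

end PairCode

/-! ### Joins, pair moves and vertex enumerations. -/

namespace SimpleGraph

variable {V W : Type*}

theorem joinGraph_adj_inl_inr (G₁ : SimpleGraph V) (G₂ : SimpleGraph W) (x : V) (y : W) :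
    (G₁.joinGraph G₂).Adj (Sum.inl x) (Sum.inr y) := by
  simp [joinGraph]

theorem joinGraph_adj_inr_inr (G₁ : SimpleGraph V) (G₂ : SimpleGraph W) {x y : W}
    (h : G₂.Adj x y) : (G₁.joinGraph G₂).Adj (Sum.inr x) (Sum.inr y) := by
  simp [joinGraph, h]

/-- Two unordered pairs are related if they arise from each other by moving one of the two elements
along an edge. -/
def PairStep (G : SimpleGraph V) (x y : Sym2 V) : Prop :=
  ∃ a b c, x = s(a, b) ∧ y = s(a, c) ∧ G.Adj b c

theorem PairStep.symm {G : SimpleGraph V} {x y : Sym2 V} : G.PairStep x y → G.PairStep y x := by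
  rintro ⟨a, b, c, rfl, rfl, h⟩
  exact ⟨a, c, b, rfl, rfl, h.symm⟩

theorem HasHamiltonianPath.exists_enum [Fintype V] [DecidableEq V] {G : SimpleGraph V}
    (h : G.HasHamiltonianPath) : ∃ v : ℕ → V, Set.InjOn v (Set.Iio (Fintype.card V)) ∧
      (∀ x, ∃ k < Fintype.card V, v k = x) ∧
      ∀ k, k + 1 < Fintype.card V → G.Adj (v k) (v (k + 1)) := by
  obtain ⟨a, b, p, hp⟩ := h
  have hpos : 0 < Fintype.card V := Fintype.card_pos_iff.2 ⟨a⟩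
  have hlen : p.length + 1 = Fintype.card V := by rw [hp.length_eq]; omega
  refine ⟨p.getVert, fun i hi j hj hij => ?_, fun x => ?_, fun k hk => ?_⟩
  · simp only [Set.mem_Iio] at hi hj
    exact hp.isPath.getVert_injOn (by rw [Set.mem_ofPred_eq]; omega)
      (by rw [Set.mem_ofPred_eq]; omega) hij
  · obtain ⟨i, hi, hle⟩ := Walk.mem_support_iff_exists_getVert.1 (hp.mem_support x)
    exact ⟨i, by omega, hi⟩
  · exact p.adj_getVert_succ (by omega)

end SimpleGraph

theorem Fintype.exists_nat_enum (V : Type*) [Fintype V] (h : 0 < Fintype.card V) :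
    ∃ w : ℕ → V, Set.InjOn w (Set.Iio (Fintype.card V)) ∧ ∀ x, ∃ k < Fintype.card V, w k = x := by
  let e := Fintype.equivFin V
  have hw : ∀ k (hk : k < Fintype.card V),
      (if hk : k < Fintype.card V then e.symm ⟨k, hk⟩ else e.symm ⟨0, h⟩) = e.symm ⟨k, hk⟩ :=
    fun k hk => dif_pos hk
  refine ⟨fun k => if hk : k < Fintype.card V then e.symm ⟨k, hk⟩ else e.symm ⟨0, h⟩,
    fun i hi j hj hij => ?_, fun x => ⟨e x, (e x).2, ?_⟩⟩
  · simp only [hw i hi, hw j hj] at hij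
    exact Fin.mk.inj (e.symm.injective hij)
  · simp

/-! ### Translating codes into unordered pairs. -/

namespace PairCode

open SimpleGraph List

variable {V W : Type*} {m n : ℕ} {d : Bool}

/-- The pair with a given code, for enumerations `w` and `v` of the two vertex sets. -/
def toSym2 (w : ℕ → V) (v : ℕ → W) : PairCode → Sym2 (V ⊕ W)
  | ww i j => s(Sum.inl (w i), Sum.inl (w j))
  | wv i k => s(Sum.inl (w i), Sum.inr (v k))
  | vv k l => s(Sum.inr (v k), Sum.inr (v l))

theorem pairStep_toSym2 {G₁ : SimpleGraph V} {G₂ : SimpleGraph W} {w : ℕ → V} {v : ℕ → W}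
    (hv : ∀ k, k + 1 < n → G₂.Adj (v k) (v (k + 1))) {c c' : PairCode}
    (hc : c.Valid m n d) (hc' : c'.Valid m n d) (h : c.Adj c') :
    (G₁.joinGraph G₂).PairStep (c.toSym2 w v) (c'.toSym2 w v) := by
  have hj := joinGraph_adj_inl_inr G₁ G₂
  have hr : ∀ k, k + 1 < n → (G₁.joinGraph G₂).Adj (Sum.inr (v k)) (Sum.inr (v (k + 1))) :=
    fun k hk => joinGraph_adj_inr_inr G₁ G₂ (hv k hk)
  have wv_ww : ∀ i k a b, (i = a ∨ i = b) →
      (G₁.joinGraph G₂).PairStep ((wv i k).toSym2 w v) ((ww a b).toSym2 w v) := by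
    rintro i k a b (rfl | rfl)
    · exact ⟨_, _, _, rfl, rfl, (hj _ _).symm⟩
    · exact ⟨_, _, _, rfl, Sym2.eq_swap, (hj _ _).symm⟩
  have wv_vv : ∀ i k a b, (k = a ∨ k = b) →
      (G₁.joinGraph G₂).PairStep ((wv i k).toSym2 w v) ((vv a b).toSym2 w v) := by
    rintro i k a b (rfl | rfl)
    · exact ⟨_, _, _, Sym2.eq_swap, rfl, hj _ _⟩
    · exact ⟨_, _, _, Sym2.eq_swap, Sym2.eq_swap, hj _ _⟩
  cases c with
  | ww a b =>
    cases c' with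
    | wv i k => exact (wv_ww i k a b h).symm
    | _ => exact h.elim
  | wv i k =>
    cases c' with
    | ww a b => exact wv_ww i k a b h
    | wv i' k' =>
      obtain ⟨rfl, rfl⟩ := h
      exact ⟨_, _, _, rfl, rfl, hr k hc'.2⟩
    | vv a b => exact wv_vv i k a b h
  | vv a b =>
    cases c' with
    | ww => exact h.elim
    | wv i k => exact (wv_vv i k a b h).symm
    | vv a' b' =>
      simp only [Valid] at hc hc'
      rcases h with ⟨rfl, rfl | rfl⟩ | ⟨rfl, rfl | rfl⟩
      · exact ⟨_, _, _, rfl, rfl, (hr _ (by omega)).symm⟩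
      · exact ⟨_, _, _, rfl, rfl, hr _ (by omega)⟩
      · exact ⟨_, _, _, Sym2.eq_swap, Sym2.eq_swap, (hr _ (by omega)).symm⟩
      · exact ⟨_, _, _, Sym2.eq_swap, Sym2.eq_swap, hr _ (by omega)⟩

theorem toSym2_injOn {w : ℕ → V} {v : ℕ → W} (hw : Set.InjOn w (Set.Iio m))
    (hv : Set.InjOn v (Set.Iio n)) {c c' : PairCode} (hc : c.Valid m n d) (hc' : c'.Valid m n d)
    (h : c.toSym2 w v = c'.toSym2 w v) : c = c' := by
  have hw' : ∀ i j, i < m → j < m → w i = w j → i = j := fun i j hi hj hij => hw hi hj hij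
  have hv' : ∀ i j, i < n → j < n → v i = v j → i = j := fun i j hi hj hij => hv hi hj hij
  cases c <;> cases c' <;> simp [toSym2, Valid] at h hc hc' ⊢ <;> grind

theorem exists_toSym2_eq {w : ℕ → V} {v : ℕ → W} (hw : ∀ x, ∃ k < m, w k = x)
    (hv : ∀ x, ∃ k < n, v k = x) (s : Sym2 (V ⊕ W)) (hs : d ∨ ¬ s.IsDiag) :
    ∃ c : PairCode, c.Valid m n d ∧ c.toSym2 w v = s := by
  induction s with | h x y
  rcases x with x | x <;> rcases y with y | y
  · obtain ⟨i, hi, rfl⟩ := hw x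
    obtain ⟨j, hj, rfl⟩ := hw y
    rcases lt_trichotomy i j with h | h | h
    · exact ⟨ww i j, ⟨Or.inl h, hj⟩, rfl⟩
    · subst h
      exact ⟨ww i i, ⟨Or.inr ⟨by simpa using hs, rfl⟩, hj⟩, rfl⟩
    · exact ⟨ww j i, ⟨Or.inl h, hi⟩, Sym2.eq_swap⟩
  · obtain ⟨i, hi, rfl⟩ := hw x
    obtain ⟨j, hj, rfl⟩ := hv y
    exact ⟨wv i j, ⟨hi, hj⟩, rfl⟩
  · obtain ⟨i, hi, rfl⟩ := hv x
    obtain ⟨j, hj, rfl⟩ := hw y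
    exact ⟨wv j i, ⟨hj, hi⟩, Sym2.eq_swap⟩
  · obtain ⟨i, hi, rfl⟩ := hv x
    obtain ⟨j, hj, rfl⟩ := hv y
    rcases lt_trichotomy i j with h | h | h
    · exact ⟨vv i j, ⟨Or.inl h, hj⟩, rfl⟩
    · subst h
      exact ⟨vv i i, ⟨Or.inr ⟨by simpa using hs, rfl⟩, hj⟩, rfl⟩
    · exact ⟨vv j i, ⟨Or.inl h, hi⟩, Sym2.eq_swap⟩

theorem not_isDiag_toSym2 {w : ℕ → V} {v : ℕ → W} (hw : Set.InjOn w (Set.Iio m))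
    (hv : Set.InjOn v (Set.Iio n)) {c : PairCode} (hc : c.Valid m n false) :
    ¬ (c.toSym2 w v).IsDiag := by
  cases c with
  | ww i j =>
    simp only [Valid, Bool.false_eq_true, false_and, or_false] at hc
    intro h
    have := hw (Set.mem_Iio.2 (hc.1.trans hc.2)) (Set.mem_Iio.2 hc.2) (by simpa [toSym2] using h)
    omega
  | wv i k => simp [toSym2]
  | vv i j =>
    simp only [Valid, Bool.false_eq_true, false_and, or_false] at hc
    intro h
    have := hv (Set.mem_Iio.2 (hc.1.trans hc.2)) (Set.mem_Iio.2 hc.2) (by simpa [toSym2] using h)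
    omega

/-- A graph whose vertices are bijectively named by the valid codes, in such a way that adjacent
codes name adjacent vertices, is Hamiltonian. -/
theorem isHamiltonian_of_naming {α : Type*} [Fintype α] [DecidableEq α] {H : SimpleGraph α}
    (hm : 1 ≤ m) (hn : 2 ≤ n) (hmn : m ≤ 2 * (if d then n - 1 else n)) (f : PairCode → α)
    (hinj : ∀ c c', c.Valid m n d → c'.Valid m n d → f c = f c' → c = c')
    (hsurj : ∀ x, ∃ c : PairCode, c.Valid m n d ∧ f c = x)
    (hadj : ∀ c c', c.Valid m n d → c'.Valid m n d → c.Adj c' → H.Adj (f c) (f c')) :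
    H.IsHamiltonian := by
  obtain ⟨l, hl⟩ := cycle_eq_cons (d := d) hm hn
  have hmem : ∀ c, c ∈ wv 0 0 :: l ↔ c.Valid m n d := fun c => hl ▸ mem_cycle hm hn hmn
  have hnodup : (wv 0 0 :: l).Nodup := hl ▸ nodup_cycle hn hmn
  have hchain : (wv 0 0 :: l ++ [wv 0 0]).IsChain Adj := hl ▸ isChain_cycle hm hn
  refine isHamiltonian_of_isChain (f (wv 0 0)) (l.map f) ?_ ?_ ?_ ?_
  · have : f (wv 0 0) :: l.map f ++ [f (wv 0 0)] = (wv 0 0 :: l ++ [wv 0 0]).map f := by simp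
    rw [this, isChain_map]
    refine hchain.imp_of_mem_imp fun c c' hc hc' h => ?_
    have hvalid : ∀ c ∈ wv 0 0 :: l ++ [wv 0 0], c.Valid m n d := by
      intro c hc
      rcases mem_append.1 hc with hc | hc
      · exact (hmem c).1 hc
      · rw [mem_singleton.1 hc]
        exact (hmem _).1 mem_cons_self
    exact hadj c c' (hvalid c hc) (hvalid c' hc') h
  · rw [← map_cons]
    exact hnodup.map_on fun c hc c' hc' h => hinj c c' ((hmem c).1 hc) ((hmem c').1 hc') h
  · intro x
    obtain ⟨c, hc, rfl⟩ := hsurj x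
    rw [← map_cons]
    exact mem_map_of_mem ((hmem c).2 hc)
  -- Two codes besides `wv 0 0` guarantee length at least three.
  · have h1 : wv 0 1 ∈ l := by
      have := (hmem (wv 0 1)).2 ⟨hm, hn⟩
      simpa using this
    have h2 : vv 0 1 ∈ l := by
      have := (hmem (vv 0 1)).2 ⟨Or.inl Nat.one_pos, hn⟩
      simpa using this
    have hsub : [wv 0 1, vv 0 1] <+~ l := by
      refine subperm_of_subset (by simp) ?_
      simp [h1, h2]
    simpa using hsub.length_le

end PairCode

/-! ### Transfer to the two graphs. -/

namespace SimpleGraph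

variable {V W : Type*} [DecidableEq V]

theorem PairStep.tokenGraph_adj {G : SimpleGraph V} {x y : Sym2 V} (h : G.PairStep x y)
    (hx : x.toFinset.card = 2) (hy : y.toFinset.card = 2) :
    G.doubleVertexGraph.Adj ⟨x.toFinset, hx⟩ ⟨y.toFinset, hy⟩ := by
  obtain ⟨a, b, c, rfl, rfl, hbc⟩ := h
  refine ⟨b, c, hbc, ?_⟩
  have hne := hbc.ne
  have hab : a ≠ b := by
    rintro rfl
    have := Sym2.card_toFinset_of_isDiag s(a, a) (by simp)
    omega
  have hac : a ≠ c := by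
    rintro rfl
    have := Sym2.card_toFinset_of_isDiag s(a, a) (by simp)
    omega
  ext z
  simp only [Finset.mem_symmDiff, Sym2.mem_toFinset, Sym2.mem_iff, Finset.mem_insert,
    Finset.mem_singleton]
  grind

/-- Multiset subtraction cancels one copy of `a` even if `a` equals `b` or `c`, so equal pairs need
no separate case. -/
theorem PairStep.multisetGraph_adj {G : SimpleGraph V} {x y : Sym2 V} (h : G.PairStep x y) :
    G.completeDoubleVertexGraph.Adj (Sym2.equivSym V x) (Sym2.equivSym V y) := by
  obtain ⟨a, b, c, rfl, rfl, hbc⟩ := h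
  refine ⟨b, c, hbc, ?_⟩
  have hne := hbc.ne
  change (({a, b} : Multiset V) - {a, c}) + ({a, c} - {a, b}) = {b, c}
  ext z
  simp only [Multiset.count_add, Multiset.count_sub, Multiset.insert_eq_cons, Multiset.count_cons,
    Multiset.count_singleton]
  grind

end SimpleGraph

theorem corollary1 {V₁ V₂ : Type*} [Fintype V₁] [DecidableEq V₁] [Fintype V₂] [DecidableEq V₂]
    (G₁ : SimpleGraph V₁) (G₂ : SimpleGraph V₂) (m n : ℕ)
    (hm : 1 ≤ m) (hn : 2 ≤ n) (hV₁ : Fintype.card V₁ = m) (hV₂ : Fintype.card V₂ = n)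
    (hpath : G₂.HasHamiltonianPath) :
    (m ≤ 2 * n → (G₁.joinGraph G₂).doubleVertexGraph.IsHamiltonian) ∧
      (m ≤ 2 * (n - 1) → (G₁.joinGraph G₂).completeDoubleVertexGraph.IsHamiltonian) := by
  obtain ⟨w, hwinj, hwsurj⟩ := Fintype.exists_nat_enum V₁ (by omega)
  obtain ⟨v, hvinj, hvsurj, hvadj⟩ := hpath.exists_enum
  rw [hV₁] at hwinj hwsurj
  rw [hV₂] at hvinj hvsurj hvadj
  constructor
  · intro hmn
    have hcard : ∀ c : PairCode, c.Valid m n false → (c.toSym2 w v).toFinset.card = 2 :=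
      fun c hc => Sym2.card_toFinset_of_not_isDiag _ (PairCode.not_isDiag_toSym2 hwinj hvinj hc)
    -- Default value for codes that do not name a two-element set.
    let A₀ : {s : Finset (V₁ ⊕ V₂) // s.card = 2} :=
      ⟨_, hcard (.wv 0 0) ⟨by omega, by omega⟩⟩
    let f : PairCode → {s : Finset (V₁ ⊕ V₂) // s.card = 2} := fun c =>
      if h : (c.toSym2 w v).toFinset.card = 2 then ⟨_, h⟩ else A₀
    have hf : ∀ c (hc : c.Valid m n false), f c = ⟨_, hcard c hc⟩ := fun c hc => dif_pos _
    refine PairCode.isHamiltonian_of_naming (d := false) hm hn (by simpa using hmn) f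
      (fun c c' hc hc' h => ?_) (fun x => ?_) (fun c c' hc hc' h => ?_)
    · rw [hf c hc, hf c' hc'] at h
      refine PairCode.toSym2_injOn hwinj hvinj hc hc' (Sym2.ext fun z => ?_)
      rw [← Sym2.mem_toFinset, ← Sym2.mem_toFinset, Subtype.mk.inj h]
    · obtain ⟨x, hx⟩ := x
      obtain ⟨a, b, hab, rfl⟩ := Finset.card_eq_two.1 hx
      obtain ⟨c, hc, hcs⟩ := PairCode.exists_toSym2_eq (d := false) hwsurj hvsurj s(a, b)
        (Or.inr (by simpa using hab))
      refine ⟨c, hc, ?_⟩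
      rw [hf c hc]
      refine Subtype.ext ?_
      ext z
      simp [hcs]
    · rw [hf c hc, hf c' hc']
      exact (PairCode.pairStep_toSym2 hvadj hc hc' h).tokenGraph_adj _ _
  · intro hmn
    refine PairCode.isHamiltonian_of_naming (d := true) hm hn (by simpa using hmn)
      (fun c => Sym2.equivSym _ (c.toSym2 w v))
      (fun c c' hc hc' h => ?_) (fun x => ?_) (fun c c' hc hc' h => ?_)
    · exact PairCode.toSym2_injOn hwinj hvinj hc hc' ((Sym2.equivSym _).injective h)
    · obtain ⟨c, hc, hcs⟩ := PairCode.exists_toSym2_eq (d := true) hwsurj hvsurj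
        ((Sym2.equivSym _).symm x) (Or.inl rfl)
      exact ⟨c, hc, by simp [hcs]⟩
    · exact (PairCode.pairStep_toSym2 hvadj hc hc' h).multisetGraph_adj
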